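/- Stochastic linear bandit. Let $d\ge 1$ and let $\theta^*\in\mathbb R^d$ be unknown. In each round $t=1,2,\dots$ the learner receives a (possibly infinite, possibly varying with $t$) arm set $\mathcal A_t$ with contexts $x_{t,a}\in\mathbb R^d$, $a\in\mathcal A_t$, chooses $A_t\in\mathcal A_t$, and, with $X_t=x_{t,A_t}$, observes $Y_t=\langle\theta^*,X_t\rangle+\eta_t$, where the noise is conditionally $R$-sub-Gaussian: almost surely $\mathbb E[e^{s\eta_t}\mid X_1,\dots,X_t,Y_1,\dots,Y_{t-1}]\le e^{s^2R^2/2}$ for all $s\in\mathbb R$. Assume that, for constants $L,S>0$, one has $\|X_t\|\le L$ and $\|\theta^*\|\le S$, and that $\max_{a\in\mathcal A_t}\langle\theta^*,x_{t,a}\rangle-\langle\theta^*,x_{t,b}\rangle\le 1$ for all $t$ and all $b\in\mathcal A_t$. The expected regret is $R_T=\mathbb E\sum_{t=1}^T\big(\max_{a\in\mathcal A_t}\langle\theta^*,x_{t,a}\rangle-\langle\theta^*,X_t\rangle\big)$. LinIMED-3, with regularization $\lambda>0$, constant $C\ge 1$ and concentration parameter $\gamma=1/t^2$ in round $t$, is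 the following algorithm. Put $V_t=\lambda I+\sum_{s\le t}X_sX_s^\top$, $\hat\theta_t=V_t^{-1}\sum_{s\le t}Y_sX_s$, $\|x\|_A=\sqrt{x^\top Ax}$ and $$\beta_{t-1}=\Big(R\sqrt{d\log\big((1+(t-1)L^2/\lambda)\,t^2\big)}+\sqrt\lambda\,S\Big)^2 .$$ In round $t$ put $\mathrm{UCB}_t(a)=\langle\hat\theta_{t-1},x_{t,a}\rangle+\sqrt{\beta_{t-1}}\,\|x_{t,a}\|_{V_{t-1}^{-1}}$, $\hat\Delta_{t,a}=\max_{j\in\mathcal A_t}\mathrm{UCB}_t(j)-\mathrm{UCB}_t(a)$ and $w_{t,a}=\beta_{t-1}\|x_{t,a}\|^2_{V_{t-1}^{-1}}$. An arm $a$ that maximizes $\mathrm{UCB}_t$ (ties broken arbitrarily) has index $I_{t,a}=\min\big\{\log\frac{C}{\max_{b\in\mathcal A_t}\hat\Delta_{t,b}^2},\,-\log w_{t,a}\big\}$, and every other arm has index $I_{t,a}=\hat\Delta_{t,a}^2/w_{t,a}-\log w_{t,a}$ (with $\log 0=-\infty$ and $\log(C/0)=+\infty$; an arm with $w_{t,a}=0$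 that is not the selected maximizer has index $+\infty$). The learner chooses $A_t\in\arg\min_{a\in\mathcal A_t}I_{t,a}$, ties broken arbitrarily. Theorem. If $\sqrt\lambda\,S\ge 1$, then the expected regret of LinIMED-3 satisfies $R_T=O(d\sqrt T\log T)$: there is a constant $K$ depending only on $\lambda,S,L,R,C$ such that $R_T\le K\,d\sqrt T\log T$ for all $T\ge 2$, uniformly in the dimension $d$, the arm sets and the parameter $\theta^*$. -/

import Mathlib

open MeasureTheory
open scoped Matrix

noncomputable section

/-- One interaction of a learner with a stochastic linear bandit in dimension `d`, on a sample
space `Ω`, with arms labelled by `ι`. Rounds are `t = 1, 2, …`; the index `t = 0` is not used.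
Arm sets and contexts may change from round to round, may be infinite and may be random
(deterministic ones are the case in which they do not depend on `ω`). -/
structure LinearBandit (d : ℕ) (ι : Type*) (Ω : Type*) where
  /-- the arm set of round `t` -/
  arms : ℕ → Ω → Set ι
  /-- the context (arm vector) of each arm in round `t` -/
  ctx : ℕ → Ω → ι → EuclideanSpace ℝ (Fin d)
  /-- the unknown parameter -/
  θ : EuclideanSpace ℝ (Fin d)
  /-- the noise of round `t` -/
  noise : ℕ → Ω → ℝ
  /-- the arm chosen by the learner in round `t` -/
  act : ℕ → Ω → ι
  /-- the learner chooses from the arm set -/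
  act_mem : ∀ t, 1 ≤ t → ∀ ω, act t ω ∈ arms t ω

/-- The norm `√(xᵀ A x)`. -/
def mahalanobis {d : ℕ} (A : Matrix (Fin d) (Fin d) ℝ) (x : EuclideanSpace ℝ (Fin d)) : ℝ :=
  √(x.ofLp ⬝ᵥ (A *ᵥ x.ofLp))

namespace LinearBandit

variable {d : ℕ} {ι Ω : Type*} (B : LinearBandit d ι Ω)

/-! ### The model -/

/-- The context `X_t` of the chosen arm. -/
def chosen (t : ℕ) (ω : Ω) : EuclideanSpace ℝ (Fin d) := B.ctx t ω (B.act t ω)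

/-- The reward `Y_t = ⟨θ, X_t⟩ + η_t`. -/
def reward (t : ℕ) (ω : Ω) : ℝ := inner ℝ B.θ (B.chosen t ω) + B.noise t ω

/-- The largest mean reward in round `t`. -/
def best (t : ℕ) (ω : Ω) : ℝ := ⨆ a : B.arms t ω, inner ℝ B.θ (B.ctx t ω a)

/-- The gap `Δ_{t,b}` between the largest mean reward and that of arm `b`. -/
def gap (t : ℕ) (ω : Ω) (b : ι) : ℝ := B.best t ω - inner ℝ B.θ (B.ctx t ω b)

/-- The (random) cumulative regret over the rounds `1, …, T`. -/
def cumRegret (T : ℕ) (ω : Ω) : ℝ :=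
  ∑ t ∈ Finset.Icc 1 T, (B.best t ω - inner ℝ B.θ (B.chosen t ω))

/-- The expected cumulative regret `R_T`. -/
def regret [MeasurableSpace Ω] (μ : Measure Ω) (T : ℕ) : ℝ := ∫ ω, B.cumRegret T ω ∂μ

/-- The information `σ(X_1, …, X_t, Y_1, …, Y_{t-1})` on which the noise of round `t` is
conditioned. When the contexts are deterministic, it is contained in
`σ(A_1, …, A_t, Y_1, …, Y_{t-1})`, so that conditions given this σ-algebra follow, by the tower
property, from the same conditions given the latter. -/
@[reducible] def history (t : ℕ) : MeasurableSpace Ω :=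
  (⨆ s ∈ Finset.Icc 1 t, MeasurableSpace.comap (B.chosen s) inferInstance) ⊔
    (⨆ s ∈ Finset.Icc 1 (t - 1), MeasurableSpace.comap (B.reward s) inferInstance)

/-- The quantities of the model are random variables. -/
structure IsMeasurable [MeasurableSpace Ω] : Prop where
  chosen : ∀ t, 1 ≤ t → Measurable (B.chosen t)
  noise : ∀ t, 1 ≤ t → Measurable (B.noise t)
  best : ∀ t, 1 ≤ t → Measurable (B.best t)

/-- The noise is conditionally `R`-sub-Gaussian: `E[exp (s η_t) | history] ≤ exp (s² R² / 2)`
almost surely, for every real `s`. -/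
def IsCondSubgaussian [MeasurableSpace Ω] (μ : Measure Ω) (R : ℝ) : Prop :=
  ∀ t, 1 ≤ t → ∀ s : ℝ,
    Integrable (fun ω => Real.exp (s * B.noise t ω)) μ ∧
    μ[fun ω => Real.exp (s * B.noise t ω) | B.history t] ≤ᵐ[μ]
      fun _ => Real.exp (s ^ 2 * R ^ 2 / 2)

/-- The boundedness assumptions: `‖X_t‖ ≤ L`, `‖θ‖ ≤ S` and `Δ_{t,b} ≤ 1` for all arms `b`. -/
structure IsBounded (L S : ℝ) : Prop where
  chosen_le : ∀ t, 1 ≤ t → ∀ ω, ‖B.chosen t ω‖ ≤ L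
  param_le : ‖B.θ‖ ≤ S
  /-- the largest mean reward is finite, so that `best` is a genuine supremum -/
  bddAbove : ∀ t, 1 ≤ t → ∀ ω,
    BddAbove (Set.range fun a : B.arms t ω => inner ℝ B.θ (B.ctx t ω a))
  gap_le : ∀ t, 1 ≤ t → ∀ ω, ∀ b ∈ B.arms t ω, B.gap t ω b ≤ 1

/-! ### The statistics of the learner (along the sample path `ω`) -/

/-- `V_0 = λ I`, `V_t = V_{t-1} + X_t X_tᵀ`. -/
def gram (lam : ℝ) (ω : Ω) : ℕ → Matrix (Fin d) (Fin d) ℝ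
  | 0 => lam • (1 : Matrix (Fin d) (Fin d) ℝ)
  | t + 1 => gram lam ω t + Matrix.vecMulVec (B.chosen (t + 1) ω).ofLp (B.chosen (t + 1) ω).ofLp

/-- `W_0 = 0`, `W_t = W_{t-1} + Y_t X_t`. -/
def moment (ω : Ω) : ℕ → EuclideanSpace ℝ (Fin d)
  | 0 => 0
  | t + 1 => moment ω t + B.reward (t + 1) ω • B.chosen (t + 1) ω

/-- The ridge estimate `θ̂_t = V_t⁻¹ W_t`. -/
def estimate (lam : ℝ) (ω : Ω) (t : ℕ) : EuclideanSpace ℝ (Fin d) :=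
  WithLp.toLp 2 ((B.gram lam ω t)⁻¹ *ᵥ (B.moment ω t).ofLp)

end LinearBandit

/-- The confidence width
`β_t(γ) = (R √(d log ((1 + t L² / λ) / γ)) + √λ S)²`. -/
def confWidth (d : ℕ) (lam S L R : ℝ) (t : ℕ) (γ : ℝ) : ℝ :=
  (R * √((d : ℝ) * Real.log ((1 + (t : ℝ) * L ^ 2 / lam) / γ)) + √lam * S) ^ 2

/-- The inputs of LinIMED-3: regularization `lam`, bounds `S` on the parameter and `L` on the
contexts, sub-Gaussian parameter `R`, constant `C`, and concentration parameter `γ t` used in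
round `t`. -/
structure LinIMEDParams where
  lam : ℝ
  S : ℝ
  L : ℝ
  R : ℝ
  C : ℝ
  γ : ℕ → ℝ

namespace LinearBandit

variable {d : ℕ} {ι Ω : Type*} (B : LinearBandit d ι Ω) (p : LinIMEDParams)

/-- The width used in round `t`, namely `β_{t-1}(γ_t)`. -/
def beta (t : ℕ) : ℝ := confWidth d p.lam p.S p.L p.R (t - 1) (p.γ t)

/-- `UCB_t(a) = ⟨θ̂_{t-1}, x_{t,a}⟩ + √β_{t-1} ‖x_{t,a}‖_{V_{t-1}⁻¹}`. -/
def ucb (t : ℕ) (ω : Ω) (a : ι) : ℝ :=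
  inner ℝ (B.estimate p.lam ω (t - 1)) (B.ctx t ω a) +
    √(beta (d := d) p t) * mahalanobis (B.gram p.lam ω (t - 1))⁻¹ (B.ctx t ω a)

/-- The empirical gap `Δ̂_{t,a} = max_j UCB_t(j) - UCB_t(a)`. -/
def empGap (t : ℕ) (ω : Ω) (a : ι) : ℝ :=
  (⨆ j : B.arms t ω, B.ucb p t ω j) - B.ucb p t ω a

/-- The squared empirical gap as an extended nonnegative real. -/
def empGapSq (t : ℕ) (ω : Ω) (a : ι) : ENNReal := ENNReal.ofReal (B.empGap p t ω a ^ 2)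

/-- The empirical variance `β_{t-1} ‖x_{t,a}‖²_{V_{t-1}⁻¹}` as an extended nonnegative real. -/
def empVar (t : ℕ) (ω : Ω) (a : ι) : ENNReal :=
  ENNReal.ofReal
    (beta (d := d) p t * mahalanobis (B.gram p.lam ω (t - 1))⁻¹ (B.ctx t ω a) ^ 2)

open Classical in
/-- The index `I_{t,a}` of LinIMED-3, with `greedy` the highest-UCB arm of the round. It takes
extended real values, with `log 0 = -∞`, `log ∞ = ∞` and `C / 0 = ∞`: so `log (C / max Δ̂²)`
is `∞` when all empirical gaps vanish, and `-log` of the variance is `∞` for a zero context. -/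
def index (t : ℕ) (ω : Ω) (greedy a : ι) : EReal :=
  if a = greedy then
    min (ENNReal.log (ENNReal.ofReal p.C / ⨆ b : B.arms t ω, B.empGapSq p t ω b))
      (-ENNReal.log (B.empVar p t ω a))
  else
    ((B.empGapSq p t ω a / B.empVar p t ω a : ENNReal) : EReal) - ENNReal.log (B.empVar p t ω a)

/-- The learner follows LinIMED-3: in every round, with `greedy` an arm of maximal UCB, the
chosen arm minimizes the index; ties are broken arbitrarily in both places. -/
def FollowsLinIMED3 : Prop :=
  ∀ t, 1 ≤ t → ∀ ω, ∃ greedy ∈ B.arms t ω,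
    (∀ j ∈ B.arms t ω, B.ucb p t ω j ≤ B.ucb p t ω greedy) ∧
    ∀ a ∈ B.arms t ω, B.index p t ω greedy (B.act t ω) ≤ B.index p t ω greedy a

end LinearBandit

end

/-! The estimation error `θ̂_t - θ` splits into a noise part `V_t⁻¹ ∑ η_s X_s` and a ridge bias `-λ
V_t⁻¹ θ`. By Cauchy–Schwarz in the `V_t⁻¹` inner product, the error in direction `x` is at most
`‖x‖` in that norm times `√selfNorm + √λ S`, so everything rests on bounding `selfNorm`, the squared
`V_t⁻¹`-norm of the noise sum.

That bound is the method of mixtures, run one step at a time. The process `exp (selfNorm / (2R²)) /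
√(det V_t / det V_0)` has expectation at most 1 (`lintegral_mixture_le_one`): a rank-one update
changes `selfNorm` by a quadratic in the new noise, whose exponential is a constant times a Gaussian
average of the functions `exp (s η)`, and each of these is controlled by sub-Gaussianity. Markov's
inequality at each fixed time gives failure probability at most `1/t` in round `t`
(`measure_badEvent_le`). No bound uniform in time is needed: a failed round costs at most 1, and the
expected cost of all failures is a harmonic sum, hence `O(log T)`.

When the confidence bounds hold, comparing the chosen arm's index with that of the highest-UCB arm
forces its squared empirical gap below `C` times its variance (`sq_empGap_act_le`). Optimism then
gives instantaneous regret at most `(2 + √C) √β ‖X_t‖` in the `V_{t-1}⁻¹` norm (`gap_act_le`). The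
squares of these are summed by the elliptical potential argument: the sum of `log (1 + leverage)`
telescopes to `log (det V_T / det V_0) = O(d log T)`. With `β = O(d log T)`, Cauchy–Schwarz over
rounds yields `d √T log T` (`cumRegret_le`). -/

/-! ### Quadratic forms and determinants under rank-one updates. -/

namespace Matrix

variable {n : Type*} [Fintype n]

theorem IsHermitian.dotProduct_mulVec_comm {A : Matrix n n ℝ} (hA : A.IsHermitian) (x y : n → ℝ) :
    x ⬝ᵥ (A *ᵥ y) = y ⬝ᵥ (A *ᵥ x) := by
  have h : Aᵀ = A := by simpa [IsHermitian, conjTranspose_eq_transpose_of_trivial] using hA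
  rw [dotProduct_mulVec, ← mulVec_transpose, h, dotProduct_comm]

theorem PosSemidef.sq_dotProduct_mulVec_le {A : Matrix n n ℝ} (hA : A.PosSemidef) (x y : n → ℝ) :
    (x ⬝ᵥ (A *ᵥ y)) ^ 2 ≤ (x ⬝ᵥ (A *ᵥ x)) * (y ⬝ᵥ (A *ᵥ y)) := by
  have h := discrim_le_zero (a := y ⬝ᵥ (A *ᵥ y)) (b := 2 * (x ⬝ᵥ (A *ᵥ y)))
    (c := x ⬝ᵥ (A *ᵥ x)) fun t => by
      have h0 : 0 ≤ (x + t • y) ⬝ᵥ (A *ᵥ (x + t • y)) := by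
        simpa using hA.dotProduct_mulVec_nonneg (x + t • y)
      have h1 : y ⬝ᵥ (A *ᵥ x) = x ⬝ᵥ (A *ᵥ y) := hA.isHermitian.dotProduct_mulVec_comm y x
      simp only [mulVec_add, mulVec_smul, dotProduct_add, add_dotProduct, smul_dotProduct,
        dotProduct_smul, smul_eq_mul, h1] at h0
      linarith
  rw [discrim] at h
  nlinarith

theorem PosDef.add_vecMulVec_self {A : Matrix n n ℝ} (hA : A.PosDef) (x : n → ℝ) :
    (A + vecMulVec x x).PosDef := by
  simpa using hA.add_posSemidef (posSemidef_vecMulVec_self_star x)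

variable [DecidableEq n]

theorem PosDef.inv_dotProduct_mulVec_nonneg {A : Matrix n n ℝ} (hA : A.PosDef) (x : n → ℝ) :
    0 ≤ x ⬝ᵥ (A⁻¹ *ᵥ x) := by
  simpa using hA.inv.posSemidef.dotProduct_mulVec_nonneg x

theorem PosDef.inv_add_vecMulVec_self {A : Matrix n n ℝ} (hA : A.PosDef) (x : n → ℝ) :
    (A + vecMulVec x x)⁻¹ =
      A⁻¹ - (1 + x ⬝ᵥ (A⁻¹ *ᵥ x))⁻¹ • vecMulVec (A⁻¹ *ᵥ x) (A⁻¹ *ᵥ x) := by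
  have hw := hA.inv_dotProduct_mulVec_nonneg x
  have hu : IsUnit A.det := (isUnit_iff_isUnit_det _).1 hA.isUnit
  have hT : A⁻¹ᵀ = A⁻¹ := by
    simpa [IsHermitian, conjTranspose_eq_transpose_of_trivial] using hA.inv.isHermitian
  have h2 : x ᵥ* A⁻¹ = A⁻¹ *ᵥ x := by rw [← mulVec_transpose, hT]
  apply inv_eq_right_inv
  rw [add_mul, mul_sub, mul_sub, mul_nonsing_inv _ hu, mul_smul_comm, mul_smul_comm, mul_vecMulVec,
    mulVec_mulVec, mul_nonsing_inv _ hu, one_mulVec, vecMulVec_mul, h2, vecMulVec_mul_vecMulVec]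
  set w := x ⬝ᵥ (A⁻¹ *ᵥ x)
  have : (1 + w) ≠ 0 := by positivity
  ext i j
  simp only [add_apply, sub_apply, smul_apply, vecMulVec_apply, smul_eq_mul, Pi.smul_apply]
  field_simp
  ring

/-- Sherman–Morrison applied to a simultaneous update of matrix and vector. The increment is a
quadratic polynomial in `y`, in exactly the shape that the Gaussian mixture step
`lintegral_exp_quadratic_le` integrates. -/
theorem PosDef.inv_add_vecMulVec_self_quadratic {A : Matrix n n ℝ} (hA : A.PosDef)
    (x s : n → ℝ) (y : ℝ) :
    (s + y • x) ⬝ᵥ ((A + vecMulVec x x)⁻¹ *ᵥ (s + y • x)) =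
      s ⬝ᵥ (A⁻¹ *ᵥ s) +
        (2 * y * (x ⬝ᵥ (A⁻¹ *ᵥ s)) + y ^ 2 * (x ⬝ᵥ (A⁻¹ *ᵥ x)) - (x ⬝ᵥ (A⁻¹ *ᵥ s)) ^ 2) /
          (1 + x ⬝ᵥ (A⁻¹ *ᵥ x)) := by
  have hw := hA.inv_dotProduct_mulVec_nonneg x
  have hc := hA.inv.isHermitian.dotProduct_mulVec_comm s x
  have e1 : (A⁻¹ *ᵥ x) ⬝ᵥ s = x ⬝ᵥ (A⁻¹ *ᵥ s) := by rw [dotProduct_comm, hc]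
  have e2 : (A⁻¹ *ᵥ x) ⬝ᵥ x = x ⬝ᵥ (A⁻¹ *ᵥ x) := dotProduct_comm _ _
  have : (1 + x ⬝ᵥ (A⁻¹ *ᵥ x)) ≠ 0 := by positivity
  rw [hA.inv_add_vecMulVec_self]
  simp only [sub_mulVec, smul_mulVec, vecMulVec_mulVec, mulVec_add, mulVec_smul, dotProduct_add,
    add_dotProduct, smul_dotProduct, dotProduct_smul, dotProduct_sub, smul_eq_mul, hc, e1, e2,
    MulOpposite.smul_eq_mul_unop, MulOpposite.unop_op]
  field_simp
  ring

theorem PosDef.det_add_vecMulVec_self {A : Matrix n n ℝ} (hA : A.PosDef) (x : n → ℝ) :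
    (A + vecMulVec x x).det = A.det * (1 + x ⬝ᵥ (A⁻¹ *ᵥ x)) := by
  have hu : IsUnit A.det := (isUnit_iff_isUnit_det _).1 hA.isUnit
  rw [vecMulVec_eq Unit, det_add_replicateCol_mul_replicateRow hu]
  congr 1
  rw [det_unique, add_apply, one_apply_eq, ← replicateRow_vecMul,
    replicateRow_mul_replicateCol_apply, dotProduct_mulVec]

/-- The determinant is the product of the eigenvalues, and each eigenvalue is the value of the
quadratic form at a unit eigenvector. -/
theorem PosDef.det_le_pow {A : Matrix n n ℝ} (hA : A.PosDef) {c : ℝ}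
    (h : ∀ x : n → ℝ, x ⬝ᵥ (A *ᵥ x) ≤ c * (x ⬝ᵥ x)) : A.det ≤ c ^ Fintype.card n := by
  have hH := hA.isHermitian
  rw [hH.det_eq_prod_eigenvalues, Fintype.card, ← Finset.prod_const]
  refine Finset.prod_le_prod (fun i _ => by simpa using (hA.eigenvalues_pos i).le) fun i _ => ?_
  have h1 := hH.eigenvalues_eq i
  have h2 : (hH.eigenvectorBasis i).ofLp ⬝ᵥ (hH.eigenvectorBasis i).ofLp = 1 := by
    have := hH.eigenvectorBasis.orthonormal.1 i
    have h3 := EuclideanSpace.inner_eq_star_dotProduct (hH.eigenvectorBasis i) (hH.eigenvectorBasis i)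
    rw [real_inner_self_eq_norm_sq, this] at h3
    simpa using h3.symm
  have h4 := h (hH.eigenvectorBasis i).ofLp
  rw [h2, mul_one] at h4
  simp only [star_trivial, RCLike.re_to_real] at h1
  simpa [h1] using h4

/-- `c xᵀ A⁻¹ x ≤ xᵀ x` when `A ≥ c I`. -/
theorem PosDef.inv_quadratic_le {A : Matrix n n ℝ} (hA : A.PosDef) {c : ℝ} (hc : 0 < c)
    (h : ∀ x : n → ℝ, c * (x ⬝ᵥ x) ≤ x ⬝ᵥ (A *ᵥ x)) (x : n → ℝ) :
    c * (x ⬝ᵥ (A⁻¹ *ᵥ x)) ≤ x ⬝ᵥ x := by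
  have hu : IsUnit A.det := (isUnit_iff_isUnit_det _).1 hA.isUnit
  have h1 := h (A⁻¹ *ᵥ x)
  rw [mulVec_mulVec, mul_nonsing_inv _ hu, one_mulVec, dotProduct_comm (A⁻¹ *ᵥ x) x] at h1
  set z := A⁻¹ *ᵥ x
  -- Expanding this square gives `x·x ≥ 2c x·z - c² z·z`, and `h1` bounds `c z·z` by `x·z`.
  have h2 : 0 ≤ (x - c • z) ⬝ᵥ (x - c • z) := by
    simpa using dotProduct_star_self_nonneg (x - c • z)
  simp only [sub_dotProduct, dotProduct_sub, smul_dotProduct, dotProduct_smul, smul_eq_mul,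
    dotProduct_comm z x] at h2
  nlinarith

end Matrix

/-! ### Gaussian mixtures of exponentials. -/

namespace ProbabilityTheory
open Real

theorem lintegral_exp_mul_gaussianReal (c : ℝ) (a : NNReal) (y : ℝ) :
    ∫⁻ s, ENNReal.ofReal (exp (s * y)) ∂gaussianReal c a =
      ENNReal.ofReal (exp (c * y + a * y ^ 2 / 2)) := by
  have h := congrFun (mgf_id_gaussianReal (μ := c) (v := a)) y
  simp only [mgf, id] at h
  rw [← h, ofReal_integral_eq_lintegral_ofReal]
  · simp only [mul_comm]
  · exact integrable_exp_mul_gaussianReal y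
  · exact Filter.Eventually.of_forall fun _ => (exp_pos _).le

/-- Completing the square: tilting this Gaussian density by `exp (s² R² / 2)` gives a constant
multiple of the density with mean `b / R²` and variance `w / R²`. The original variance is below `1
/ R²`, which is why the integral is finite. -/
theorem lintegral_exp_sq_gaussianReal {R w b : ℝ} (hR : 0 < R) (hw : 0 < w) :
    ∫⁻ s, ENNReal.ofReal (exp (s ^ 2 * R ^ 2 / 2))
        ∂gaussianReal (b / (R ^ 2 * (1 + w))) (w / (R ^ 2 * (1 + w))).toNNReal =
      ENNReal.ofReal (√(1 + w) * exp (b ^ 2 / (2 * R ^ 2 * (1 + w)))) := by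
  have ha : 0 < w / (R ^ 2 * (1 + w)) := by positivity
  have ha' : 0 < w / R ^ 2 := by positivity
  have hv : (w / (R ^ 2 * (1 + w))).toNNReal ≠ 0 := by simpa using ha
  have hv' : (w / R ^ 2).toNNReal ≠ 0 := by simpa using ha'
  have key : ∀ s, gaussianPDFReal (b / (R ^ 2 * (1 + w))) (w / (R ^ 2 * (1 + w))).toNNReal s *
      exp (s ^ 2 * R ^ 2 / 2) = (√(1 + w) * exp (b ^ 2 / (2 * R ^ 2 * (1 + w)))) *
        gaussianPDFReal (b / R ^ 2) (w / R ^ 2).toNNReal s := by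
    intro s
    simp only [gaussianPDFReal, Real.coe_toNNReal _ ha.le, Real.coe_toNNReal _ ha'.le]
    have h1 : (√(2 * π * (w / (R ^ 2 * (1 + w)))))⁻¹ =
        √(1 + w) * (√(2 * π * (w / R ^ 2)))⁻¹ := by
      rw [show 2 * π * (w / R ^ 2) = (1 + w) * (2 * π * (w / (R ^ 2 * (1 + w)))) by field_simp,
        Real.sqrt_mul (show 0 ≤ 1 + w by positivity)]
      have : √(1 + w) ≠ 0 := by positivity
      field_simp
    rw [h1]
    have h2 : exp (-(s - b / (R ^ 2 * (1 + w))) ^ 2 / (2 * (w / (R ^ 2 * (1 + w))))) *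
        exp (s ^ 2 * R ^ 2 / 2) = exp (b ^ 2 / (2 * R ^ 2 * (1 + w))) *
          exp (-(s - b / R ^ 2) ^ 2 / (2 * (w / R ^ 2))) := by
      rw [← Real.exp_add, ← Real.exp_add]
      congr 1
      field_simp
      ring
    linear_combination (√(1 + w) * (√(2 * π * (w / R ^ 2)))⁻¹) * h2
  rw [gaussianReal_of_var_ne_zero _ hv, lintegral_withDensity_eq_lintegral_mul _
    (measurable_gaussianPDF _ _) (by fun_prop)]
  simp only [Pi.mul_apply, gaussianPDF]
  simp_rw [← ENNReal.ofReal_mul (gaussianPDFReal_nonneg _ _ _), key]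
  simp_rw [ENNReal.ofReal_mul (show 0 ≤ √(1 + w) * exp (b ^ 2 / (2 * R ^ 2 * (1 + w))) by positivity)]
  rw [lintegral_const_mul _ (by fun_prop), lintegral_gaussianPDFReal_eq_one _ hv', mul_one]

/-- One step of the method of mixtures. -/
theorem lintegral_exp_quadratic_le {ν : Measure ℝ} [SFinite ν] {R : ℝ} (hR : 0 < R)
    (hν : ∀ s : ℝ, ∫⁻ y, ENNReal.ofReal (exp (s * y)) ∂ν ≤
      ENNReal.ofReal (exp (s ^ 2 * R ^ 2 / 2))) (b : ℝ) {w : ℝ} (hw : 0 ≤ w) :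
    ∫⁻ y, ENNReal.ofReal (exp ((2 * y * b + y ^ 2 * w - b ^ 2) / (1 + w) / (2 * R ^ 2))) ∂ν ≤
      ENNReal.ofReal √(1 + w) := by
  have hsplit : ∀ y : ℝ, ENNReal.ofReal
      (exp ((2 * y * b + y ^ 2 * w - b ^ 2) / (1 + w) / (2 * R ^ 2))) =
      ENNReal.ofReal (exp (-(b ^ 2 / (2 * R ^ 2 * (1 + w))))) *
        ENNReal.ofReal (exp (b / (R ^ 2 * (1 + w)) * y + w / (R ^ 2 * (1 + w)) * y ^ 2 / 2)) := by
    intro y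
    rw [← ENNReal.ofReal_mul (exp_pos _).le, ← Real.exp_add]
    congr 2
    field_simp
    ring
  simp_rw [hsplit]
  rw [lintegral_const_mul _ (by fun_prop)]
  have hmain : ∫⁻ y, ENNReal.ofReal
      (exp (b / (R ^ 2 * (1 + w)) * y + w / (R ^ 2 * (1 + w)) * y ^ 2 / 2)) ∂ν ≤
      ENNReal.ofReal (√(1 + w) * exp (b ^ 2 / (2 * R ^ 2 * (1 + w)))) := by
    -- For `w = 0` the mixing Gaussian degenerates to a point mass without density; there the
    -- sub-Gaussian bound at the single value `s = b / R²` suffices.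
    rcases hw.eq_or_lt with rfl | hw
    · refine le_trans (le_of_eq ?_) ((hν (b / R ^ 2)).trans (le_of_eq ?_))
      · simp
      · congr 1
        simp only [add_zero, mul_one, Real.sqrt_one, one_mul]
        congr 1
        field_simp
    · rw [← lintegral_exp_sq_gaussianReal hR hw]
      have ha : 0 < w / (R ^ 2 * (1 + w)) := by positivity
      -- The quadratic exponential is the moment generating function, at `y`, of a Gaussian in `s`.
      -- Tonelli then puts the integral over `ν` inside, where `hν` applies for each `s`.
      have h1 : ∀ y : ℝ, ENNReal.ofReal
          (exp (b / (R ^ 2 * (1 + w)) * y + w / (R ^ 2 * (1 + w)) * y ^ 2 / 2)) =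
          ∫⁻ s, ENNReal.ofReal (exp (s * y))
            ∂gaussianReal (b / (R ^ 2 * (1 + w))) (w / (R ^ 2 * (1 + w))).toNNReal := by
        intro y
        rw [lintegral_exp_mul_gaussianReal, Real.coe_toNNReal _ ha.le]
      simp_rw [h1]
      rw [lintegral_lintegral_swap (by fun_prop)]
      exact lintegral_mono fun s => hν s
  refine (mul_le_mul_right hmain _).trans (le_of_eq ?_)
  rw [← ENNReal.ofReal_mul (exp_pos _).le, mul_left_comm, ← Real.exp_add]
  simp

end ProbabilityTheory

/-! ### Passing from conditional expectations to conditional distributions. -/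

namespace ProbabilityTheory
open Real Filter Topology

/-- The conditional sub-Gaussian bound has an exceptional null set for each `s`, so only countably
many `s` can be treated at once. Fatou's lemma along rationals tending to `s` recovers all real
values. -/
theorem lintegral_exp_mul_le_of_forall_rat {ν : Measure ℝ} {R : ℝ}
    (h : ∀ q : ℚ, ∫⁻ y, ENNReal.ofReal (exp (q * y)) ∂ν ≤
      ENNReal.ofReal (exp ((q : ℝ) ^ 2 * R ^ 2 / 2))) (s : ℝ) :
    ∫⁻ y, ENNReal.ofReal (exp (s * y)) ∂ν ≤ ENNReal.ofReal (exp (s ^ 2 * R ^ 2 / 2)) := by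
  obtain ⟨u, hu, hlim⟩ := mem_closure_iff_seq_limit.1 (Rat.denseRange_cast (𝕜 := ℝ) s)
  choose q hq using hu
  have h1 : ∀ y : ℝ, Tendsto (fun n => ENNReal.ofReal (exp (q n * y))) atTop
      (𝓝 (ENNReal.ofReal (exp (s * y)))) := fun y => by
    simp_rw [hq]
    exact ENNReal.tendsto_ofReal ((Real.continuous_exp.tendsto _).comp (hlim.mul_const y))
  have h2 : Tendsto (fun n => ENNReal.ofReal (exp ((q n : ℝ) ^ 2 * R ^ 2 / 2))) atTop
      (𝓝 (ENNReal.ofReal (exp (s ^ 2 * R ^ 2 / 2)))) := by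
    simp_rw [hq]
    exact ENNReal.tendsto_ofReal ((Real.continuous_exp.tendsto _).comp
      (((hlim.pow 2).mul_const _).div_const _))
  calc ∫⁻ y, ENNReal.ofReal (exp (s * y)) ∂ν
      = ∫⁻ y, liminf (fun n => ENNReal.ofReal (exp (q n * y))) atTop ∂ν := by
        simp_rw [fun y => (h1 y).liminf_eq]
    _ ≤ liminf (fun n => ∫⁻ y, ENNReal.ofReal (exp (q n * y)) ∂ν) atTop :=
        lintegral_liminf_le fun n => by fun_prop
    _ ≤ liminf (fun n => ENNReal.ofReal (exp ((q n : ℝ) ^ 2 * R ^ 2 / 2))) atTop :=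
        liminf_le_liminf (Eventually.of_forall fun n => h (q n))
    _ = _ := h2.liminf_eq

variable {Ω β : Type*} {mΩ : MeasurableSpace Ω} {mβ : MeasurableSpace β} {μ : Measure Ω}
  [IsProbabilityMeasure μ] {X : Ω → β} {η : Ω → ℝ}

theorem lintegral_prodMk_eq_lintegral_condDistrib (hX : Measurable X) (hη : Measurable η)
    {f : β × ℝ → ENNReal} (hf : Measurable f) :
    ∫⁻ ω, f (X ω, η ω) ∂μ = ∫⁻ ω, ∫⁻ y, f (X ω, y) ∂condDistrib η X μ (X ω) ∂μ := by
  rw [← lintegral_map (f := f) hf (hX.prodMk hη), ← compProd_map_condDistrib hη.aemeasurable,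
    Measure.lintegral_compProd hf, lintegral_map _ hX]
  exact hf.lintegral_kernel_prod_right'

theorem ae_condDistrib_lintegral_exp_le {R : ℝ} (hX : Measurable X) (hη : Measurable η)
    (hsub : ∀ s : ℝ, Integrable (fun ω => exp (s * η ω)) μ ∧
      μ[fun ω => exp (s * η ω) | mβ.comap X] ≤ᵐ[μ] fun _ => exp (s ^ 2 * R ^ 2 / 2)) :
    ∀ᵐ ω ∂μ, ∀ s : ℝ, ∫⁻ y, ENNReal.ofReal (exp (s * y)) ∂condDistrib η X μ (X ω) ≤
      ENNReal.ofReal (exp (s ^ 2 * R ^ 2 / 2)) := by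
  have h : ∀ᵐ ω ∂μ, ∀ q : ℚ, ∫⁻ y, ENNReal.ofReal (exp (q * y)) ∂condDistrib η X μ (X ω) ≤
      ENNReal.ofReal (exp ((q : ℝ) ^ 2 * R ^ 2 / 2)) := by
    rw [ae_all_iff]
    intro q
    obtain ⟨hi, hle⟩ := hsub q
    have hsm : StronglyMeasurable fun y : ℝ => exp (q * y) := by fun_prop
    have h1 := condExp_ae_eq_integral_condDistrib (μ := μ) hX hη.aemeasurable hsm hi
    have h2 : ∀ᵐ ω ∂μ, Integrable (fun y : ℝ => exp (q * y)) (condDistrib η X μ (X ω)) := by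
      refine Integrable.condDistrib_ae (f := fun p : β × ℝ => exp (q * p.2)) hX.aemeasurable
        hη.aemeasurable ?_
      rw [integrable_map_measure (by fun_prop) (by fun_prop)]
      exact hi
    filter_upwards [h1, h2, hle] with ω h1 h2 h3
    rw [← ofReal_integral_eq_lintegral_ofReal h2 (Eventually.of_forall fun _ => (exp_pos _).le),
      ← h1]
    exact ENNReal.ofReal_le_ofReal h3
  filter_upwards [h] with ω hω s using lintegral_exp_mul_le_of_forall_rat hω s

/-- Supermartingale step: given `X`, the quantities `F`, `b`, `w` are frozen, and
`lintegral_exp_quadratic_le` applies to the conditional law of the noise. The factor `√(1 + w)` it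
produces is cancelled by the normalization. -/
theorem lintegral_mul_exp_quadratic_le {R : ℝ} (hR : 0 < R) (hX : Measurable X)
    (hη : Measurable η)
    (hsub : ∀ s : ℝ, Integrable (fun ω => exp (s * η ω)) μ ∧
      μ[fun ω => exp (s * η ω) | mβ.comap X] ≤ᵐ[μ] fun _ => exp (s ^ 2 * R ^ 2 / 2))
    {F : β → ENNReal} (hF : Measurable F) {b w : β → ℝ} (hb : Measurable b) (hw : Measurable w)
    (hw0 : ∀ x, 0 ≤ w x) :
    ∫⁻ ω, F (X ω) * ENNReal.ofReal (exp ((2 * η ω * b (X ω) + η ω ^ 2 * w (X ω) - b (X ω) ^ 2) /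
        (1 + w (X ω)) / (2 * R ^ 2)) / √(1 + w (X ω))) ∂μ ≤ ∫⁻ ω, F (X ω) ∂μ := by
  rw [lintegral_prodMk_eq_lintegral_condDistrib (f := fun p => F p.1 * ENNReal.ofReal
    (exp ((2 * p.2 * b p.1 + p.2 ^ 2 * w p.1 - b p.1 ^ 2) / (1 + w p.1) / (2 * R ^ 2)) /
      √(1 + w p.1))) hX hη (by fun_prop)]
  refine lintegral_mono_ae ?_
  filter_upwards [ae_condDistrib_lintegral_exp_le hX hη hsub] with ω hω
  have h0 := hw0 (X ω)
  have hpos : 0 < √(1 + w (X ω)) := by positivity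
  rw [lintegral_const_mul _ (by fun_prop)]
  refine (mul_le_mul_right ?_ _).trans (mul_one _).le
  simp_rw [div_eq_mul_inv _ (√(1 + w (X ω))), ENNReal.ofReal_mul (exp_pos _).le]
  rw [lintegral_mul_const _ (by fun_prop)]
  refine (mul_le_mul_left (lintegral_exp_quadratic_le hR hω (b (X ω)) h0) _).trans ?_
  rw [← ENNReal.ofReal_mul hpos.le, mul_inv_cancel₀ hpos.ne', ENNReal.ofReal_one]

end ProbabilityTheory

/-! ### Measurability of matrix operations. -/

namespace Matrix

variable {n α : Type*} [Fintype n] [MeasurableSpace α] {A : α → Matrix n n ℝ}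

theorem measurable_dotProduct_mulVec {x y : α → n → ℝ} (hA : ∀ i j, Measurable fun a => A a i j)
    (hx : ∀ i, Measurable fun a => x a i) (hy : ∀ i, Measurable fun a => y a i) :
    Measurable fun a => x a ⬝ᵥ (A a *ᵥ y a) := by
  simp only [dotProduct, mulVec]
  fun_prop

variable [DecidableEq n]

theorem measurable_det_of_entries (hA : ∀ i j, Measurable fun a => A a i j) :
    Measurable fun a => (A a).det := by
  simp only [det_apply']
  fun_prop

theorem measurable_inv_entry (hA : ∀ i j, Measurable fun a => A a i j) (i j : n) :
    Measurable fun a => (A a)⁻¹ i j := by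
  simp only [inv_def, smul_apply, Ring.inverse_eq_inv', smul_eq_mul, adjugate_apply]
  refine (measurable_det_of_entries hA).inv.mul (measurable_det_of_entries fun k l => ?_)
  simp only [updateRow_apply]
  split_ifs
  · exact measurable_const
  · exact hA k l

end Matrix

/-! ### The self-normalized noise bound. -/

namespace LinearBandit

variable {d : ℕ} {ι Ω : Type*} (B : LinearBandit d ι Ω) (lam : ℝ)

/-- The noise-weighted sum `∑_{s ≤ t} η_s X_s`. -/
noncomputable def noiseSum (ω : Ω) : ℕ → Fin d → ℝ
  | 0 => 0
  | t + 1 => noiseSum ω t + B.noise (t + 1) ω • (B.chosen (t + 1) ω).ofLp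

/-- `‖∑_{s ≤ t} η_s X_s‖²` in the norm of `V_t⁻¹`. -/
noncomputable def selfNorm (ω : Ω) (t : ℕ) : ℝ := B.noiseSum ω t ⬝ᵥ ((B.gram lam ω t)⁻¹ *ᵥ B.noiseSum ω t)

/-- `‖X_{t+1}‖²` in the norm of `V_t⁻¹`. -/
noncomputable def leverage (ω : Ω) (t : ℕ) : ℝ :=
  (B.chosen (t + 1) ω).ofLp ⬝ᵥ ((B.gram lam ω t)⁻¹ *ᵥ (B.chosen (t + 1) ω).ofLp)

/-- `det V_t / det V_0`. -/
noncomputable def detRatio (ω : Ω) (t : ℕ) : ℝ := (B.gram lam ω t).det / lam ^ d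

variable {lam}

theorem gram_posDef (hlam : 0 < lam) (ω : Ω) (t : ℕ) : (B.gram lam ω t).PosDef := by
  induction t with
  | zero => exact Matrix.PosDef.one.smul hlam
  | succ t ih => exact ih.add_vecMulVec_self _

theorem leverage_nonneg (hlam : 0 < lam) (ω : Ω) (t : ℕ) : 0 ≤ B.leverage lam ω t :=
  (B.gram_posDef hlam ω t).inv_dotProduct_mulVec_nonneg _

theorem detRatio_zero (hlam : 0 < lam) (ω : Ω) : B.detRatio lam ω 0 = 1 := by
  simp [detRatio, gram, hlam.ne']

theorem detRatio_succ (hlam : 0 < lam) (ω : Ω) (t : ℕ) :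
    B.detRatio lam ω (t + 1) = B.detRatio lam ω t * (1 + B.leverage lam ω t) := by
  rw [detRatio, gram, (B.gram_posDef hlam ω t).det_add_vecMulVec_self, detRatio, leverage]
  ring

theorem one_le_detRatio (hlam : 0 < lam) (ω : Ω) (t : ℕ) : 1 ≤ B.detRatio lam ω t := by
  induction t with
  | zero => exact (B.detRatio_zero hlam ω).ge
  | succ t ih =>
    rw [B.detRatio_succ hlam]
    nlinarith [B.leverage_nonneg hlam ω t]

theorem selfNorm_succ (hlam : 0 < lam) (ω : Ω) (t : ℕ) :
    B.selfNorm lam ω (t + 1) = B.selfNorm lam ω t +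
      (2 * B.noise (t + 1) ω *
          ((B.chosen (t + 1) ω).ofLp ⬝ᵥ ((B.gram lam ω t)⁻¹ *ᵥ B.noiseSum ω t)) +
        B.noise (t + 1) ω ^ 2 * B.leverage lam ω t -
        ((B.chosen (t + 1) ω).ofLp ⬝ᵥ ((B.gram lam ω t)⁻¹ *ᵥ B.noiseSum ω t)) ^ 2) /
          (1 + B.leverage lam ω t) :=
  (B.gram_posDef hlam ω t).inv_add_vecMulVec_self_quadratic _ _ _

section Measurability

variable [MeasurableSpace Ω] {t : ℕ}

theorem measurable_coord {s : ℕ} (h : Measurable (B.chosen s)) (i : Fin d) :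
    Measurable fun ω => (B.chosen s ω).ofLp i :=
  (by fun_prop : Measurable fun x : EuclideanSpace ℝ (Fin d) => x.ofLp i).comp h

theorem measurable_gram (h : ∀ s ∈ Finset.Icc 1 t, Measurable (B.chosen s)) (i j : Fin d) :
    Measurable fun ω => B.gram lam ω t i j := by
  induction t with
  | zero => exact measurable_const
  | succ t ih =>
    have h1 := B.measurable_coord (h (t + 1) (by simp))
    simp only [gram, Matrix.add_apply, Matrix.vecMulVec_apply]
    exact (ih fun s hs => h s (by simp at hs ⊢; omega)).add ((h1 i).mul (h1 j))

theorem measurable_noiseSum (h : ∀ s ∈ Finset.Icc 1 t, Measurable (B.chosen s))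
    (hn : ∀ s ∈ Finset.Icc 1 t, Measurable (B.noise s)) (i : Fin d) :
    Measurable fun ω => B.noiseSum ω t i := by
  induction t with
  | zero => exact measurable_const
  | succ t ih =>
    have h1 := B.measurable_coord (h (t + 1) (by simp))
    simp only [noiseSum, Pi.add_apply, Pi.smul_apply, smul_eq_mul]
    exact (ih (fun s hs => h s (by simp at hs ⊢; omega))
      fun s hs => hn s (by simp at hs ⊢; omega)).add ((hn (t + 1) (by simp)).mul (h1 i))

theorem measurable_selfNorm (h : ∀ s ∈ Finset.Icc 1 t, Measurable (B.chosen s))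
    (hn : ∀ s ∈ Finset.Icc 1 t, Measurable (B.noise s)) :
    Measurable fun ω => B.selfNorm lam ω t :=
  Matrix.measurable_dotProduct_mulVec (Matrix.measurable_inv_entry (B.measurable_gram h))
    (B.measurable_noiseSum h hn) (B.measurable_noiseSum h hn)

theorem measurable_detRatio (h : ∀ s ∈ Finset.Icc 1 t, Measurable (B.chosen s)) :
    Measurable fun ω => B.detRatio lam ω t :=
  (Matrix.measurable_det_of_entries (B.measurable_gram h)).div_const _

theorem measurable_leverage (h : ∀ s ∈ Finset.Icc 1 (t + 1), Measurable (B.chosen s)) :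
    Measurable fun ω => B.leverage lam ω t :=
  Matrix.measurable_dotProduct_mulVec
    (Matrix.measurable_inv_entry (B.measurable_gram fun s hs => h s (by simp at hs ⊢; omega)))
    (B.measurable_coord (h _ (by simp))) (B.measurable_coord (h _ (by simp)))

end Measurability

theorem history_le [mΩ : MeasurableSpace Ω] (hB : B.IsMeasurable) (t : ℕ) :
    B.history t ≤ mΩ := by
  refine sup_le (iSup₂_le fun s hs => ?_) (iSup₂_le fun s hs => ?_)
  · exact (hB.chosen s (Finset.mem_Icc.1 hs).1).comap_le
  · have h1 := hB.chosen s (Finset.mem_Icc.1 hs).1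
    have h2 := hB.noise s (Finset.mem_Icc.1 hs).1
    have : Measurable (B.reward s) := by unfold reward; fun_prop
    exact this.comap_le

theorem measurable_history_chosen {s t : ℕ} (hs : s ∈ Finset.Icc 1 t) :
    Measurable[B.history t] (B.chosen s) :=
  Measurable.of_comap_le (le_sup_of_le_left (le_iSup₂_of_le s hs le_rfl))

/-- The history contains rewards, not noise; subtracting the mean reward, a function of `X_s`,
recovers the noise of past rounds. -/
theorem measurable_history_noise {s t : ℕ} (hs : s ∈ Finset.Icc 1 t) :
    Measurable[B.history (t + 1)] (B.noise s) := by
  have h1 : Measurable[B.history (t + 1)] (B.reward s) :=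
    Measurable.of_comap_le (le_sup_of_le_right (le_iSup₂_of_le s (by simpa using hs) le_rfl))
  have h2 : Measurable[B.history (t + 1)] (B.chosen s) :=
    B.measurable_history_chosen (by simp at hs ⊢; omega)
  have h3 : B.noise s = fun ω => B.reward s ω - inner ℝ B.θ (B.chosen s ω) := by
    ext ω; simp [reward]
  rw [h3]
  fun_prop

variable (lam) in
/-- The mixture supermartingale `exp (‖∑ η_s X_s‖² / (2 R²)) / √(det V_t / det V_0)`. -/
noncomputable def mixture (R : ℝ) (t : ℕ) (ω : Ω) : ENNReal :=
  ENNReal.ofReal (Real.exp (B.selfNorm lam ω t / (2 * R ^ 2)) / √(B.detRatio lam ω t))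

theorem lintegral_mixture_le_one [mΩ : MeasurableSpace Ω] (hlam : 0 < lam) {μ : Measure Ω}
    [IsProbabilityMeasure μ] (hB : B.IsMeasurable) {R : ℝ} (hR : 0 < R)
    (hsub : B.IsCondSubgaussian μ R) (t : ℕ) : ∫⁻ ω, B.mixture lam R t ω ∂μ ≤ 1 := by
  induction t with
  | zero => simp [mixture, selfNorm, noiseSum, B.detRatio_zero hlam]
  | succ t ih =>
    refine le_trans ?_ ih
    have hm := B.history_le hB (t + 1)
    have hch : ∀ s ∈ Finset.Icc 1 (t + 1), Measurable[B.history (t + 1)] (B.chosen s) :=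
      fun s hs => B.measurable_history_chosen hs
    have hch' : ∀ s ∈ Finset.Icc 1 t, Measurable[B.history (t + 1)] (B.chosen s) :=
      fun s hs => hch s (by simp at hs ⊢; omega)
    have hno : ∀ s ∈ Finset.Icc 1 t, Measurable[B.history (t + 1)] (B.noise s) :=
      fun s hs => B.measurable_history_noise hs
    have hF : Measurable[B.history (t + 1)] (B.mixture lam R t) :=
      letI := B.history (t + 1)
      (((B.measurable_selfNorm hch' hno).div_const _).exp.div
        (B.measurable_detRatio hch').sqrt).ennreal_ofReal
    have hb : Measurable[B.history (t + 1)] fun ω =>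
        (B.chosen (t + 1) ω).ofLp ⬝ᵥ ((B.gram lam ω t)⁻¹ *ᵥ B.noiseSum ω t) :=
      letI := B.history (t + 1)
      Matrix.measurable_dotProduct_mulVec (Matrix.measurable_inv_entry (B.measurable_gram hch'))
        (B.measurable_coord (hch _ (by simp))) (B.measurable_noiseSum hch' hno)
    have hw : Measurable[B.history (t + 1)] fun ω => B.leverage lam ω t :=
      letI := B.history (t + 1)
      B.measurable_leverage hch
    -- Conditioning on the history is conditioning on the identity map from `Ω` to `Ω` equipped with
    -- the smaller σ-algebra.
    have key := ProbabilityTheory.lintegral_mul_exp_quadratic_le (mβ := B.history (t + 1))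
      (X := id) (μ := μ) hR (measurable_id'' hm) (hB.noise (t + 1) (by omega))
      (by simpa only [MeasurableSpace.comap_id] using hsub (t + 1) (by omega)) hF hb hw
      (B.leverage_nonneg hlam · t)
    refine le_trans (le_of_eq ?_) key
    refine lintegral_congr fun ω => ?_
    have h1 := B.one_le_detRatio hlam ω t
    simp only [mixture, id]
    rw [← ENNReal.ofReal_mul (by positivity), B.selfNorm_succ hlam, B.detRatio_succ hlam,
      Real.sqrt_mul (by linarith), add_div, Real.exp_add, mul_div_mul_comm]

theorem IsCondSubgaussian.mono [MeasurableSpace Ω] {μ : Measure Ω} {B : LinearBandit d ι Ω}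
    {R R' : ℝ} (h : B.IsCondSubgaussian μ R) (hR : 0 ≤ R) (hR' : R ≤ R') :
    B.IsCondSubgaussian μ R' := fun t ht s => by
  refine ⟨(h t ht s).1, (h t ht s).2.trans (Filter.Eventually.of_forall fun _ => ?_)⟩
  simp only
  gcongr

variable (lam) in
/-- The event that the self-normalized bound used in round `t + 1` fails. -/
def badEvent (R : ℝ) (t : ℕ) : Set Ω :=
  {ω | R ^ 2 * (2 * Real.log (t + 1) + Real.log (B.detRatio lam ω t)) < B.selfNorm lam ω t}

theorem measurableSet_badEvent [MeasurableSpace Ω] (hB : B.IsMeasurable) (R : ℝ) (t : ℕ) :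
    MeasurableSet (B.badEvent lam R t) := by
  have hch : ∀ s ∈ Finset.Icc 1 t, Measurable (B.chosen s) :=
    fun s hs => hB.chosen s (Finset.mem_Icc.1 hs).1
  have hno : ∀ s ∈ Finset.Icc 1 t, Measurable (B.noise s) :=
    fun s hs => hB.noise s (Finset.mem_Icc.1 hs).1
  exact measurableSet_lt (((B.measurable_detRatio hch).log.const_add _).const_mul _)
    (B.measurable_selfNorm hch hno)

/-- Markov's inequality for the mixture at level `t + 1`. Since `selfNorm` is divided by `2 R²`,
that level is the term `2 log (t + 1)` in the threshold, so `γ = 1/t²` in a round means failure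
probability `1/t`. -/
theorem measure_badEvent_le_of_pos [MeasurableSpace Ω] (hlam : 0 < lam) {μ : Measure Ω}
    [IsProbabilityMeasure μ] (hB : B.IsMeasurable) {R : ℝ} (hR : 0 < R)
    (hsub : B.IsCondSubgaussian μ R) (t : ℕ) :
    μ (B.badEvent lam R t) ≤ ENNReal.ofReal (1 / (t + 1)) := by
  have hch : ∀ s ∈ Finset.Icc 1 t, Measurable (B.chosen s) :=
    fun s hs => hB.chosen s (Finset.mem_Icc.1 hs).1
  have hno : ∀ s ∈ Finset.Icc 1 t, Measurable (B.noise s) :=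
    fun s hs => hB.noise s (Finset.mem_Icc.1 hs).1
  have hF : Measurable (B.mixture lam R t) :=
    (((B.measurable_selfNorm hch hno).div_const _).exp.div
      (B.measurable_detRatio hch).sqrt).ennreal_ofReal
  have ht : (0 : ℝ) < t + 1 := by positivity
  have hsubset : B.badEvent lam R t ⊆ {ω | ENNReal.ofReal (t + 1) ≤ B.mixture lam R t ω} := by
    intro ω hω
    have hD : 0 < B.detRatio lam ω t := zero_lt_one.trans_le (B.one_le_detRatio hlam ω t)
    refine ENNReal.ofReal_le_ofReal ?_
    rw [le_div_iff₀ (by positivity)]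
    have h1 : ((t : ℝ) + 1) * √(B.detRatio lam ω t) =
        Real.exp (Real.log (t + 1) + Real.log (B.detRatio lam ω t) / 2) := by
      rw [Real.exp_add, Real.exp_log ht, ← Real.log_sqrt hD.le, Real.exp_log (by positivity)]
    rw [h1, Real.exp_le_exp, le_div_iff₀ (by positivity)]
    have : R ^ 2 * (2 * Real.log (t + 1) + Real.log (B.detRatio lam ω t)) <
      B.selfNorm lam ω t := hω
    linarith
  refine (measure_mono hsubset).trans ?_
  have h2 := (meas_ge_le_lintegral_div hF.aemeasurable (ε := ENNReal.ofReal ((t : ℝ) + 1))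
    (by simpa using ht) ENNReal.ofReal_ne_top).trans
    (ENNReal.div_le_div_right (B.lintegral_mixture_le_one hlam hB hR hsub t) _)
  rwa [one_div, ENNReal.ofReal_inv_of_pos ht, ← one_div]

/-- The mixture divides by `R²`, so `R = 0` needs a limit. Noise that is `R`-sub-Gaussian is so for
every larger parameter, and as that parameter decreases to `R` the bad events increase and cover the
one at `R`, its defining inequality being strict. -/
theorem measure_badEvent_le [MeasurableSpace Ω] (hlam : 0 < lam) {μ : Measure Ω}
    [IsProbabilityMeasure μ] (hB : B.IsMeasurable) {R : ℝ} (hR : 0 ≤ R)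
    (hsub : B.IsCondSubgaussian μ R) (t : ℕ) :
    μ (B.badEvent lam R t) ≤ ENNReal.ofReal (1 / (t + 1)) := by
  have hRn : ∀ n : ℕ, 0 < R + 1 / ((n : ℝ) + 1) := fun n => by positivity
  have hmono : Monotone fun n : ℕ => B.badEvent lam (R + 1 / ((n : ℝ) + 1)) t := by
    intro m n hmn ω hω
    refine lt_of_le_of_lt ?_ (show _ < B.selfNorm lam ω t from hω)
    have h1 := Real.log_nonneg (B.one_le_detRatio hlam ω t)
    have h2 : 0 ≤ Real.log ((t : ℝ) + 1) := Real.log_nonneg (by simp)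
    gcongr
  have hsubset : B.badEvent lam R t ⊆ ⋃ n : ℕ, B.badEvent lam (R + 1 / ((n : ℝ) + 1)) t := by
    intro ω hω
    have h1 := (((tendsto_one_div_add_atTop_nhds_zero_nat (𝕜 := ℝ)).const_add R).pow 2).mul_const
      (2 * Real.log (t + 1) + Real.log (B.detRatio lam ω t))
    rw [add_zero] at h1
    obtain ⟨n, hn⟩ := (h1.eventually_lt_const hω).exists
    exact Set.mem_iUnion.2 ⟨n, hn⟩
  refine (measure_mono hsubset).trans ?_
  rw [hmono.measure_iUnion]
  exact iSup_le fun n => B.measure_badEvent_le_of_pos hlam hB (hRn n)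
    (hsub.mono hR (by simp; positivity)) t

end LinearBandit

/-! ### Confidence bounds and the index comparison. -/

namespace LinearBandit

variable {d : ℕ} {ι Ω : Type*} (B : LinearBandit d ι Ω) {lam S L R C : ℝ}

theorem EuclideanSpace.dotProduct_self_eq {d : ℕ} (x : EuclideanSpace ℝ (Fin d)) :
    x.ofLp ⬝ᵥ x.ofLp = ‖x‖ ^ 2 := by
  rw [← real_inner_self_eq_norm_sq, EuclideanSpace.inner_eq_star_dotProduct, star_trivial]

theorem le_gram_quadratic (ω : Ω) (t : ℕ) (x : Fin d → ℝ) :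
    lam * (x ⬝ᵥ x) ≤ x ⬝ᵥ (B.gram lam ω t *ᵥ x) := by
  induction t with
  | zero => simp [gram, Matrix.smul_mulVec]
  | succ t ih =>
    have h : (B.chosen (t + 1) ω).ofLp ⬝ᵥ x = x ⬝ᵥ (B.chosen (t + 1) ω).ofLp :=
      dotProduct_comm _ _
    simp only [gram, Matrix.add_mulVec, Matrix.vecMulVec_mulVec, dotProduct_add, dotProduct_smul,
      MulOpposite.smul_eq_mul_unop, MulOpposite.unop_op, h]
    nlinarith [mul_self_nonneg (x ⬝ᵥ (B.chosen (t + 1) ω).ofLp)]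

theorem gram_quadratic_le {ω : Ω} {t : ℕ} (hX : ∀ s, 1 ≤ s → ‖B.chosen s ω‖ ≤ L)
    (x : Fin d → ℝ) :
    x ⬝ᵥ (B.gram lam ω t *ᵥ x) ≤ (lam + t * L ^ 2) * (x ⬝ᵥ x) := by
  induction t with
  | zero => simp [gram, Matrix.smul_mulVec]
  | succ t ih =>
    have h : (B.chosen (t + 1) ω).ofLp ⬝ᵥ x = x ⬝ᵥ (B.chosen (t + 1) ω).ofLp :=
      dotProduct_comm _ _
    have h1 := Matrix.PosSemidef.one.sq_dotProduct_mulVec_le x (B.chosen (t + 1) ω).ofLp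
    simp only [Matrix.one_mulVec] at h1
    have h2 : (B.chosen (t + 1) ω).ofLp ⬝ᵥ (B.chosen (t + 1) ω).ofLp ≤ L ^ 2 := by
      rw [EuclideanSpace.dotProduct_self_eq]
      exact pow_le_pow_left₀ (norm_nonneg _) (hX _ (by omega)) 2
    have h3 : 0 ≤ x ⬝ᵥ x := by simpa using dotProduct_star_self_nonneg x
    have h4 := mul_le_mul_of_nonneg_left h2 h3
    simp only [gram, Matrix.add_mulVec, Matrix.vecMulVec_mulVec, dotProduct_add, dotProduct_smul,
      MulOpposite.smul_eq_mul_unop, MulOpposite.unop_op, h]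
    push_cast
    nlinarith

theorem log_detRatio_le (hlam : 0 < lam) {ω : Ω} (t : ℕ)
    (hX : ∀ s, 1 ≤ s → ‖B.chosen s ω‖ ≤ L) :
    Real.log (B.detRatio lam ω t) ≤ d * Real.log (1 + t * L ^ 2 / lam) := by
  rw [← Real.log_pow]
  refine Real.log_le_log (zero_lt_one.trans_le (B.one_le_detRatio hlam ω t)) ?_
  have h := (B.gram_posDef hlam ω t).det_le_pow (B.gram_quadratic_le hX)
  rw [detRatio, div_le_iff₀ (by positivity), ← mul_pow]
  refine h.trans (le_of_eq ?_)
  rw [Fintype.card_fin]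
  congr 1
  field_simp

theorem sum_log_one_add_leverage (hlam : 0 < lam) (ω : Ω) (T : ℕ) :
    ∑ k ∈ Finset.range T, Real.log (1 + B.leverage lam ω k) = Real.log (B.detRatio lam ω T) := by
  induction T with
  | zero => simp [B.detRatio_zero hlam]
  | succ T ih =>
    have h1 := B.leverage_nonneg hlam ω T
    have h2 := B.one_le_detRatio hlam ω T
    rw [Finset.sum_range_succ, ih, B.detRatio_succ hlam, Real.log_mul (by positivity) (by positivity)]

/-- Since `∑ X_s X_sᵀ = V_t - λ I`, the rewards' mean part contributes `V_t θ - λ θ`; applying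
`V_t⁻¹` isolates the noise and bias terms of the estimation error. -/
theorem moment_eq (ω : Ω) (t : ℕ) :
    (B.moment ω t).ofLp = B.noiseSum ω t + B.gram lam ω t *ᵥ B.θ.ofLp - lam • B.θ.ofLp := by
  induction t with
  | zero => simp [moment, noiseSum, gram, Matrix.smul_mulVec]
  | succ t ih =>
    have h : (B.chosen (t + 1) ω).ofLp ⬝ᵥ B.θ.ofLp = inner ℝ B.θ (B.chosen (t + 1) ω) := by
      rw [EuclideanSpace.inner_eq_star_dotProduct, star_trivial]
    ext i
    have ih := congrFun ih i
    simp only [moment, noiseSum, gram, reward, Matrix.add_mulVec, Matrix.vecMulVec_mulVec, h,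
      PiLp.add_apply, PiLp.smul_apply, Pi.add_apply, Pi.sub_apply, Pi.smul_apply, smul_eq_mul,
      MulOpposite.smul_eq_mul_unop, MulOpposite.unop_op] at ih ⊢
    rw [ih]
    ring

theorem mahalanobis_nonneg {A : Matrix (Fin d) (Fin d) ℝ} (x : EuclideanSpace ℝ (Fin d)) :
    0 ≤ mahalanobis A x := Real.sqrt_nonneg _

/-- The estimation error in a direction `x`, in terms of the self-normalized noise. -/
theorem abs_inner_estimate_sub_le (hlam : 0 < lam) (hθ : ‖B.θ‖ ≤ S) (ω : Ω) (t : ℕ)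
    (x : EuclideanSpace ℝ (Fin d)) :
    |inner ℝ (B.estimate lam ω t) x - inner ℝ B.θ x| ≤
      (√(B.selfNorm lam ω t) + √lam * S) * mahalanobis (B.gram lam ω t)⁻¹ x := by
  have hV := B.gram_posDef hlam ω t
  have hu : IsUnit (B.gram lam ω t).det := (Matrix.isUnit_iff_isUnit_det _).1 hV.isUnit
  have hP := hV.inv.posSemidef
  have heq : inner ℝ (B.estimate lam ω t) x - inner ℝ B.θ x =
      x.ofLp ⬝ᵥ ((B.gram lam ω t)⁻¹ *ᵥ B.noiseSum ω t) -
        lam * (x.ofLp ⬝ᵥ ((B.gram lam ω t)⁻¹ *ᵥ B.θ.ofLp)) := by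
    simp only [EuclideanSpace.inner_eq_star_dotProduct, star_trivial, estimate, B.moment_eq (lam := lam)]
    rw [Matrix.mulVec_sub, Matrix.mulVec_add, Matrix.mulVec_mulVec, Matrix.nonsing_inv_mul _ hu,
      Matrix.one_mulVec, Matrix.mulVec_smul]
    simp only [dotProduct_add, dotProduct_sub, dotProduct_smul, smul_eq_mul]
    ring
  have h1 : |x.ofLp ⬝ᵥ ((B.gram lam ω t)⁻¹ *ᵥ B.noiseSum ω t)| ≤
      mahalanobis (B.gram lam ω t)⁻¹ x * √(B.selfNorm lam ω t) := by
    rw [mahalanobis, ← Real.sqrt_mul (hV.inv_dotProduct_mulVec_nonneg _)]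
    exact Real.abs_le_sqrt (hP.sq_dotProduct_mulVec_le _ _)
  have h2 : |lam * (x.ofLp ⬝ᵥ ((B.gram lam ω t)⁻¹ *ᵥ B.θ.ofLp))| ≤
      mahalanobis (B.gram lam ω t)⁻¹ x * (√lam * S) := by
    have hS : 0 ≤ S := (norm_nonneg _).trans hθ
    have hx0 := hV.inv_dotProduct_mulVec_nonneg x.ofLp
    have h3 := hP.sq_dotProduct_mulVec_le x.ofLp B.θ.ofLp
    have h4 := hV.inv_quadratic_le hlam (B.le_gram_quadratic ω t) B.θ.ofLp
    rw [EuclideanSpace.dotProduct_self_eq] at h4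
    have h5 : ‖B.θ‖ ^ 2 ≤ S ^ 2 := pow_le_pow_left₀ (norm_nonneg _) hθ 2
    rw [mahalanobis, ← Real.sqrt_sq hS, ← Real.sqrt_mul hlam.le, ← Real.sqrt_mul hx0]
    refine Real.abs_le_sqrt ?_
    rw [mul_pow]
    calc lam ^ 2 * (x.ofLp ⬝ᵥ ((B.gram lam ω t)⁻¹ *ᵥ B.θ.ofLp)) ^ 2
        ≤ lam ^ 2 * ((x.ofLp ⬝ᵥ ((B.gram lam ω t)⁻¹ *ᵥ x.ofLp)) *
          (B.θ.ofLp ⬝ᵥ ((B.gram lam ω t)⁻¹ *ᵥ B.θ.ofLp))) := by gcongr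
      _ = (x.ofLp ⬝ᵥ ((B.gram lam ω t)⁻¹ *ᵥ x.ofLp)) *
          (lam * (lam * (B.θ.ofLp ⬝ᵥ ((B.gram lam ω t)⁻¹ *ᵥ B.θ.ofLp)))) := by ring
      _ ≤ _ := by gcongr; exact h4.trans h5
  rw [heq]
  refine (abs_sub _ _).trans ?_
  linarith

theorem abs_inner_estimate_sub_le_of_notMem_badEvent (hd : 1 ≤ d) (hlam : 0 < lam) (hR : 0 ≤ R)
    (hS : 0 < S) (hθ : ‖B.θ‖ ≤ S) {ω : Ω} {t : ℕ} (hX : ∀ s, 1 ≤ s → ‖B.chosen s ω‖ ≤ L)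
    (hω : ω ∉ B.badEvent lam R t) (x : EuclideanSpace ℝ (Fin d)) :
    |inner ℝ (B.estimate lam ω t) x - inner ℝ B.θ x| ≤
      √(confWidth d lam S L R t (1 / ((t + 1 : ℕ) : ℝ) ^ 2)) *
        mahalanobis (B.gram lam ω t)⁻¹ x := by
  refine (B.abs_inner_estimate_sub_le hlam hθ ω t x).trans
    (mul_le_mul_of_nonneg_right ?_ (mahalanobis_nonneg x))
  rw [confWidth, Real.sqrt_sq (by positivity)]
  gcongr
  have h1 : B.selfNorm lam ω t ≤
      R ^ 2 * (2 * Real.log (t + 1) + Real.log (B.detRatio lam ω t)) := not_lt.1 hω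
  have h2 := B.log_detRatio_le hlam t hX
  have h3 : 0 ≤ Real.log ((t : ℝ) + 1) := Real.log_nonneg (by simp)
  have hd' : (1 : ℝ) ≤ d := by exact_mod_cast hd
  have hlog : Real.log ((1 + t * L ^ 2 / lam) / (1 / ((t + 1 : ℕ) : ℝ) ^ 2)) =
      Real.log (1 + t * L ^ 2 / lam) + 2 * Real.log (t + 1) := by
    rw [div_div_eq_mul_div, div_one, Real.log_mul (by positivity) (by positivity), Real.log_pow]
    push_cast
    rfl
  rw [← Real.sqrt_sq hR, ← Real.sqrt_mul (sq_nonneg R)]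
  refine Real.sqrt_le_sqrt (h1.trans ?_)
  rw [hlog]
  -- `confWidth` multiplies the whole logarithm by `d`, whereas only the determinant term needs it;
  -- `1 ≤ d` pays for the surplus on `2 log (t + 1)`.
  gcongr
  nlinarith

section Index

variable {p : LinIMEDParams} {t : ℕ} {ω : Ω} {greedy : ι}

theorem empGap_eq (hg : greedy ∈ B.arms t ω)
    (hmax : ∀ j ∈ B.arms t ω, B.ucb p t ω j ≤ B.ucb p t ω greedy) (a : ι) :
    B.empGap p t ω a = B.ucb p t ω greedy - B.ucb p t ω a := by
  have : Nonempty (B.arms t ω) := ⟨⟨greedy, hg⟩⟩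
  rw [empGap]
  congr 1
  exact le_antisymm (ciSup_le fun j => hmax j j.2)
    (le_ciSup (f := fun j : B.arms t ω => B.ucb p t ω j)
      ⟨B.ucb p t ω greedy, by rintro _ ⟨j, rfl⟩; exact hmax j j.2⟩ ⟨greedy, hg⟩)

/-- The chosen arm has a small empirical gap, compared with its empirical variance. -/
theorem sq_empGap_act_le (hC : 1 ≤ p.C) (hact : B.act t ω ∈ B.arms t ω)
    (hg : greedy ∈ B.arms t ω)
    (hmax : ∀ j ∈ B.arms t ω, B.ucb p t ω j ≤ B.ucb p t ω greedy)
    (hmin : ∀ a ∈ B.arms t ω, B.index p t ω greedy (B.act t ω) ≤ B.index p t ω greedy a)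
    (hβ : 0 ≤ beta (d := d) p t) :
    B.empGap p t ω (B.act t ω) ^ 2 ≤ p.C *
      (beta (d := d) p t * mahalanobis (B.gram p.lam ω (t - 1))⁻¹ (B.chosen t ω) ^ 2) := by
  by_cases hag : B.act t ω = greedy
  · rw [B.empGap_eq hg hmax, hag, sub_self, zero_pow two_ne_zero]
    have hC0 : 0 ≤ p.C := by linarith
    positivity
  by_contra! hlt
  -- The chosen index is at most the first entry of the greedy minimum, and by `h2` at least `-log`
  -- of its own variance. Together these say `1 / variance ≤ C / max gap²`.
  have h1 : B.index p t ω greedy (B.act t ω) ≤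
      ENNReal.log (ENNReal.ofReal p.C / ⨆ b : B.arms t ω, B.empGapSq p t ω b) :=
    (hmin greedy hg).trans (by rw [index, if_pos rfl]; exact min_le_left _ _)
  have h2 : -ENNReal.log (B.empVar p t ω (B.act t ω)) ≤ B.index p t ω greedy (B.act t ω) := by
    rw [index, if_neg hag, sub_eq_add_neg]
    exact le_add_of_nonneg_left (EReal.coe_ennreal_nonneg _)
  have h3 : B.empGapSq p t ω (B.act t ω) ≤ ⨆ b : B.arms t ω, B.empGapSq p t ω b :=
    le_iSup (fun b : B.arms t ω => B.empGapSq p t ω b) ⟨B.act t ω, hact⟩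
  have h4 : (B.empVar p t ω (B.act t ω))⁻¹ ≤
      ENNReal.ofReal p.C / B.empGapSq p t ω (B.act t ω) := by
    have := (h2.trans h1).trans (ENNReal.log_le_log (ENNReal.div_le_div_left h3 _))
    rwa [← ENNReal.log_inv, ENNReal.log_le_log_iff] at this
  have hC0 : 0 < p.C := by linarith
  -- The contradiction is drawn in `ENNReal`, so a vanishing variance (infinite inverse) needs no
  -- separate case.
  have h5 : ENNReal.ofReal p.C * B.empVar p t ω (B.act t ω) <
      B.empGapSq p t ω (B.act t ω) := by
    rw [empVar, empGapSq, ← ENNReal.ofReal_mul hC0.le]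
    exact (ENNReal.ofReal_lt_ofReal_iff_of_nonneg (by positivity)).2 hlt
  have h6 : ENNReal.ofReal p.C / B.empGapSq p t ω (B.act t ω) <
      (B.empVar p t ω (B.act t ω))⁻¹ := by
    have hG0 : B.empGapSq p t ω (B.act t ω) ≠ 0 := (zero_le.trans_lt h5).ne'
    have hW : B.empVar p t ω (B.act t ω) ≠ ⊤ := ENNReal.ofReal_ne_top
    rw [ENNReal.div_lt_iff (Or.inl hG0) (Or.inl ENNReal.ofReal_ne_top), mul_comm,
      ← div_eq_mul_inv, ENNReal.lt_div_iff_mul_lt (Or.inr ENNReal.ofReal_ne_top) (Or.inl hW)]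
    exact h5
  exact absurd h4 (not_le.2 h6)

/-- Where the confidence bounds hold, the regret of the chosen arm is of the order of its
confidence width. -/
theorem gap_act_le (hC : 1 ≤ p.C) (hact : B.act t ω ∈ B.arms t ω)
    (hg : greedy ∈ B.arms t ω)
    (hmax : ∀ j ∈ B.arms t ω, B.ucb p t ω j ≤ B.ucb p t ω greedy)
    (hmin : ∀ a ∈ B.arms t ω, B.index p t ω greedy (B.act t ω) ≤ B.index p t ω greedy a)
    (hβ : 0 ≤ beta (d := d) p t)
    (hconf : ∀ x, |inner ℝ (B.estimate p.lam ω (t - 1)) x - inner ℝ B.θ x| ≤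
      √(beta (d := d) p t) * mahalanobis (B.gram p.lam ω (t - 1))⁻¹ x) :
    B.best t ω - inner ℝ B.θ (B.chosen t ω) ≤ (2 + √p.C) *
      (√(beta (d := d) p t) * mahalanobis (B.gram p.lam ω (t - 1))⁻¹ (B.chosen t ω)) := by
  have : Nonempty (B.arms t ω) := ⟨⟨greedy, hg⟩⟩
  -- Optimism: every mean reward lies below its UCB, hence below the greedy one. The regret is then
  -- the empirical gap (at most `√C` widths) plus UCB minus mean for the chosen arm (at most two
  -- widths).
  have hbest : B.best t ω ≤ B.ucb p t ω greedy := ciSup_le fun j => by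
    have h := (abs_le.1 (hconf (B.ctx t ω j))).1
    have h' := hmax j j.2
    rw [ucb] at h'
    linarith
  have hsq := B.sq_empGap_act_le hC hact hg hmax hmin hβ
  have hgap := Real.le_sqrt_of_sq_le hsq
  rw [Real.sqrt_mul (by linarith), Real.sqrt_mul hβ, Real.sqrt_sq (mahalanobis_nonneg _),
    B.empGap_eq hg hmax] at hgap
  have h1 := (abs_le.1 (hconf (B.chosen t ω))).2
  have h2 : B.ucb p t ω (B.act t ω) = inner ℝ (B.estimate p.lam ω (t - 1)) (B.chosen t ω) +
    √(beta (d := d) p t) * mahalanobis (B.gram p.lam ω (t - 1))⁻¹ (B.chosen t ω) := rfl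
  linarith

end Index

end LinearBandit

/-! ### Summing the regret. -/

namespace LinearBandit

variable {d : ℕ} {ι Ω : Type*} (B : LinearBandit d ι Ω) {lam S L R C : ℝ}

theorem one_le_confWidth (hlamS : 1 ≤ √lam * S) (hR : 0 ≤ R) (t : ℕ) (γ : ℝ) :
    1 ≤ confWidth d lam S L R t γ :=
  one_le_pow₀ (hlamS.trans (le_add_of_nonneg_left (by positivity)))

variable (lam L) in
/-- A constant `k` such that `log ((1 + T L² / lam) T²) ≤ k log T` for `T ≥ 2`. -/
noncomputable def logConst : ℝ := Real.log (1 + L ^ 2 / lam) / Real.log 2 + 3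

theorem logConst_pos (hlam : 0 < lam) : 0 < logConst lam L := by
  have h1 : 0 ≤ Real.log (1 + L ^ 2 / lam) :=
    Real.log_nonneg (le_add_of_nonneg_right (by positivity))
  have h2 := Real.log_pos one_lt_two
  unfold logConst
  positivity

theorem log_two_le_log {T : ℕ} (hT : 2 ≤ T) : Real.log 2 ≤ Real.log T :=
  Real.log_le_log two_pos (by exact_mod_cast hT)

theorem log_one_add_mul_le (hlam : 0 < lam) {T : ℕ} (hT : 2 ≤ T) :
    Real.log (1 + T * L ^ 2 / lam) + 2 * Real.log T ≤ logConst lam L * Real.log T := by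
  have hT1 : (1 : ℝ) ≤ T := by exact_mod_cast (by omega : 1 ≤ T)
  have h1 : Real.log (1 + T * L ^ 2 / lam) ≤ Real.log (1 + L ^ 2 / lam) + Real.log T := by
    rw [← Real.log_mul (by positivity) (by positivity)]
    refine Real.log_le_log (by positivity) ?_
    rw [add_mul, one_mul, mul_comm (T : ℝ), mul_div_right_comm]
    linarith
  have h2 : Real.log (1 + L ^ 2 / lam) ≤ Real.log (1 + L ^ 2 / lam) / Real.log 2 * Real.log T := by
    have h3 : 0 ≤ Real.log (1 + L ^ 2 / lam) :=
      Real.log_nonneg (le_add_of_nonneg_right (by positivity))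
    have h4 := Real.log_pos one_lt_two
    calc _ = Real.log (1 + L ^ 2 / lam) / Real.log 2 * Real.log 2 := by field_simp
      _ ≤ _ := mul_le_mul_of_nonneg_left (log_two_le_log hT) (div_nonneg h3 h4.le)
  rw [logConst, add_mul]
  linarith

theorem log_detRatio_le_logConst (hlam : 0 < lam) {ω : Ω} {T : ℕ} (hT : 2 ≤ T)
    (hX : ∀ s, 1 ≤ s → ‖B.chosen s ω‖ ≤ L) :
    Real.log (B.detRatio lam ω T) ≤ d * (logConst lam L * Real.log T) := by
  refine (B.log_detRatio_le hlam T hX).trans ?_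
  have h1 := log_one_add_mul_le (L := L) hlam hT
  have h2 := log_two_le_log hT
  have h3 := Real.log_pos one_lt_two
  gcongr
  linarith

theorem confWidth_le (hd : 1 ≤ d) (hlam : 0 < lam) {T k : ℕ} (hT : 2 ≤ T)
    (hk : k < T) : confWidth d lam S L R k (1 / ((k + 1 : ℕ) : ℝ) ^ 2) ≤
      (2 * R ^ 2 * logConst lam L + 2 * lam * S ^ 2 / Real.log 2) * (d * Real.log T) := by
  have hl2 := Real.log_pos one_lt_two
  have hlT := log_two_le_log hT
  have hd' : (1 : ℝ) ≤ d := by exact_mod_cast hd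
  have hlog : Real.log ((1 + k * L ^ 2 / lam) / (1 / ((k + 1 : ℕ) : ℝ) ^ 2)) ≤
      logConst lam L * Real.log T := by
    refine le_trans ?_ (log_one_add_mul_le hlam hT)
    have hT0 : (0 : ℝ) < T := by exact_mod_cast (by omega : 0 < T)
    have hkT : ((k + 1 : ℕ) : ℝ) ≤ T := by exact_mod_cast hk
    have hkT' : (k : ℝ) ≤ T := by exact_mod_cast hk.le
    rw [div_div_eq_mul_div, div_one, Real.log_mul (by positivity) (by positivity), Real.log_pow]
    push_cast at hkT ⊢
    gcongr
  have hlog0 : 0 ≤ Real.log ((1 + k * L ^ 2 / lam) / (1 / ((k + 1 : ℕ) : ℝ) ^ 2)) := by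
    refine Real.log_nonneg ?_
    rw [div_div_eq_mul_div, div_one]
    push_cast
    have h1 : (1 : ℝ) ≤ 1 + k * L ^ 2 / lam := le_add_of_nonneg_right (by positivity)
    have h2 : (1 : ℝ) ≤ ((k : ℝ) + 1) ^ 2 := one_le_pow₀ (by simp)
    nlinarith
  rw [confWidth]
  -- `(a + b)² ≤ 2 (a² + b²)` separates noise from bias; the constant bias term is absorbed using
  -- `log T ≥ log 2` and `d ≥ 1`.
  refine (add_sq_le).trans ?_
  rw [mul_pow, mul_pow, Real.sq_sqrt (by positivity), Real.sq_sqrt hlam.le]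
  have h3 : R ^ 2 * (d * Real.log ((1 + k * L ^ 2 / lam) / (1 / ((k + 1 : ℕ) : ℝ) ^ 2))) ≤
      R ^ 2 * (d * (logConst lam L * Real.log T)) := by gcongr
  have h4 : lam * S ^ 2 ≤ lam * S ^ 2 / Real.log 2 * (d * Real.log T) := by
    calc lam * S ^ 2 = lam * S ^ 2 / Real.log 2 * (1 * Real.log 2) := by field_simp
      _ ≤ _ := by gcongr
  have h5 : 2 * lam * S ^ 2 / Real.log 2 = 2 * (lam * S ^ 2 / Real.log 2) := by ring
  rw [h5]
  linarith

theorem min_one_le_two_mul_log_one_add {x : ℝ} (hx : 0 ≤ x) : min 1 x ≤ 2 * Real.log (1 + x) := by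
  have h := Real.le_log_one_add_of_nonneg hx
  have : min 1 x ≤ 2 * (2 * x / (x + 2)) := by
    rw [← mul_div_assoc, le_div_iff₀ (by positivity)]
    rcases le_total 1 x with h1 | h1
    · rw [min_eq_left h1]; linarith
    · rw [min_eq_right h1]; nlinarith
  linarith

theorem gap_chosen_nonneg (hbdd : B.IsBounded L S) {t : ℕ} (ht : 1 ≤ t) (ω : Ω) :
    0 ≤ B.best t ω - inner ℝ B.θ (B.chosen t ω) :=
  sub_nonneg.2 (le_ciSup (f := fun a : B.arms t ω => inner ℝ B.θ (B.ctx t ω a))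
    (hbdd.bddAbove t ht ω) ⟨B.act t ω, B.act_mem t ht ω⟩)

theorem gap_chosen_le_one (hbdd : B.IsBounded L S) {t : ℕ} (ht : 1 ≤ t) (ω : Ω) :
    B.best t ω - inner ℝ B.θ (B.chosen t ω) ≤ 1 :=
  hbdd.gap_le t ht ω _ (B.act_mem t ht ω)

theorem cumRegret_eq_sum_range (T : ℕ) (ω : Ω) : B.cumRegret T ω =
    ∑ k ∈ Finset.range T, (B.best (k + 1) ω - inner ℝ B.θ (B.chosen (k + 1) ω)) := by
  rw [Finset.range_eq_Ico,
    Finset.sum_Ico_add' (fun t => B.best t ω - inner ℝ B.θ (B.chosen t ω)) 0 T 1, cumRegret]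
  rfl

theorem integrable_cumRegret [MeasurableSpace Ω] {μ : Measure Ω} [IsProbabilityMeasure μ]
    (hB : B.IsMeasurable) (hbdd : B.IsBounded L S) (T : ℕ) : Integrable (B.cumRegret T) μ := by
  unfold cumRegret
  refine integrable_finsetSum _ fun t ht => ?_
  have ht1 := (Finset.mem_Icc.1 ht).1
  have h1 := hB.best t ht1
  have h2 := hB.chosen t ht1
  refine Integrable.of_bound (C := 1) (by fun_prop) (Filter.Eventually.of_forall fun ω => ?_)
  rw [Real.norm_of_nonneg (B.gap_chosen_nonneg hbdd ht1 ω)]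
  exact B.gap_chosen_le_one hbdd ht1 ω

/-- The squared regret of a round in which the confidence bounds hold. -/
theorem sq_gap_chosen_le (hd : 1 ≤ d) (hlam : 0 < lam) (hS : 0 < S) (hR : 0 ≤ R)
    (hlamS : 1 ≤ √lam * S) (hC : 1 ≤ C) (hbdd : B.IsBounded L S)
    (hfol : B.FollowsLinIMED3
      { lam := lam, S := S, L := L, R := R, C := C, γ := fun t => 1 / (t : ℝ) ^ 2 })
    {k : ℕ} {ω : Ω} (hω : ω ∉ B.badEvent lam R k) :
    (B.best (k + 1) ω - inner ℝ B.θ (B.chosen (k + 1) ω)) ^ 2 ≤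
      (2 + √C) ^ 2 * confWidth d lam S L R k (1 / ((k + 1 : ℕ) : ℝ) ^ 2) *
        (2 * Real.log (1 + B.leverage lam ω k)) := by
  obtain ⟨greedy, hg, hmax, hmin⟩ := hfol (k + 1) (by omega) ω
  have hX : ∀ s, 1 ≤ s → ‖B.chosen s ω‖ ≤ L := fun s hs => hbdd.chosen_le s hs ω
  have hβ := one_le_confWidth (d := d) (L := L) hlamS hR k (1 / ((k + 1 : ℕ) : ℝ) ^ 2)
  have hgap := B.gap_act_le hC (B.act_mem (k + 1) (by omega) ω) hg hmax hmin
    (zero_le_one.trans hβ)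
    (B.abs_inner_estimate_sub_le_of_notMem_badEvent hd hlam hR hS hbdd.param_le hX hω)
  have h0 := B.gap_chosen_nonneg hbdd (by omega : 1 ≤ k + 1) ω
  have h1 := B.gap_chosen_le_one hbdd (by omega : 1 ≤ k + 1) ω
  have hl := B.leverage_nonneg hlam ω k
  have hc : 1 ≤ (2 + √C) ^ 2 := one_le_pow₀ (by linarith [Real.sqrt_nonneg C])
  -- Round `k + 1` uses `V_k`, so the Mahalanobis norm is by definition the square root of the
  -- leverage at index `k`.
  change _ ≤ (2 + √C) * (√(confWidth d lam S L R k (1 / ((k + 1 : ℕ) : ℝ) ^ 2)) *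
    √(B.leverage lam ω k)) at hgap
  set β := confWidth d lam S L R k (1 / ((k + 1 : ℕ) : ℝ) ^ 2)
  refine le_trans ?_ (mul_le_mul_of_nonneg_left (min_one_le_two_mul_log_one_add hl) (by positivity))
  rw [mul_min_of_nonneg _ _ (by positivity)]
  -- The bound by 1 uses gaps at most 1 and `β ≥ 1`; the latter is where `√λ S ≥ 1` enters.
  -- Truncating at 1 is what allows the leverage to be replaced by a logarithm without assuming it
  -- small.
  refine le_min ?_ ?_
  · have : 1 ≤ (2 + √C) ^ 2 * β := one_le_mul_of_one_le_of_one_le hc hβ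
    nlinarith
  · refine (pow_le_pow_left₀ h0 hgap 2).trans (le_of_eq ?_)
    rw [mul_pow, mul_pow, Real.sq_sqrt (by linarith), Real.sq_sqrt hl]
    ring

/-- On every sample path, the regret is at most the number of failures of the confidence bounds
plus a term of order `d √T log T`. -/
theorem cumRegret_le (hd : 1 ≤ d) (hlam : 0 < lam) (hS : 0 < S) (hR : 0 ≤ R)
    (hlamS : 1 ≤ √lam * S) (hC : 1 ≤ C) (hbdd : B.IsBounded L S)
    (hfol : B.FollowsLinIMED3
      { lam := lam, S := S, L := L, R := R, C := C, γ := fun t => 1 / (t : ℝ) ^ 2 })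
    {T : ℕ} (hT : 2 ≤ T) (ω : Ω) :
    B.cumRegret T ω ≤
      ∑ k ∈ Finset.range T, (B.badEvent lam R k).indicator (fun _ => (1 : ℝ)) ω +
      (2 + √C) * √(2 * (2 * R ^ 2 * logConst lam L + 2 * lam * S ^ 2 / Real.log 2) *
        logConst lam L) * (d * √(T : ℝ) * Real.log T) := by
  classical
  have hX : ∀ s, 1 ≤ s → ‖B.chosen s ω‖ ≤ L := fun s hs => hbdd.chosen_le s hs ω
  have hl2 := Real.log_pos one_lt_two
  have hlT : 0 < Real.log T := hl2.trans_le (log_two_le_log hT)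
  have hk := logConst_pos (L := L) hlam
  set Kβ := 2 * R ^ 2 * logConst lam L + 2 * lam * S ^ 2 / Real.log 2 with hKβ
  have hKβ0 : 0 ≤ Kβ := by positivity
  -- Regret with the failed rounds deleted; those are charged 1 each to the indicator sum.
  set g : ℕ → ℝ := fun k => if ω ∈ B.badEvent lam R k then 0 else
    B.best (k + 1) ω - inner ℝ B.θ (B.chosen (k + 1) ω) with hgdef
  have hsplit : B.cumRegret T ω ≤
      ∑ k ∈ Finset.range T, (B.badEvent lam R k).indicator (fun _ => (1 : ℝ)) ω +
        ∑ k ∈ Finset.range T, g k := by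
    rw [cumRegret_eq_sum_range, ← Finset.sum_add_distrib]
    refine Finset.sum_le_sum fun k _ => ?_
    by_cases h : ω ∈ B.badEvent lam R k
    · simpa [g, h] using B.gap_chosen_le_one hbdd (by omega : 1 ≤ k + 1) ω
    · simp [g, h]
  refine hsplit.trans (add_le_add le_rfl ?_)
  have hsq : ∑ k ∈ Finset.range T, g k ^ 2 ≤
      (2 + √C) ^ 2 * (Kβ * (d * Real.log T)) * (2 * (d * (logConst lam L * Real.log T))) := by
    calc ∑ k ∈ Finset.range T, g k ^ 2
        ≤ ∑ k ∈ Finset.range T, (2 + √C) ^ 2 * (Kβ * (d * Real.log T)) *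
          (2 * Real.log (1 + B.leverage lam ω k)) := by
          refine Finset.sum_le_sum fun k hkT => ?_
          have hlog : 0 ≤ Real.log (1 + B.leverage lam ω k) :=
            Real.log_nonneg (le_add_of_nonneg_right (B.leverage_nonneg hlam ω k))
          by_cases h : ω ∈ B.badEvent lam R k
          · simp only [g, h, if_true]
            rw [zero_pow two_ne_zero]
            positivity
          · simp only [g, h, if_false]
            refine (B.sq_gap_chosen_le hd hlam hS hR hlamS hC hbdd hfol h).trans ?_
            gcongr
            exact confWidth_le hd hlam hT (Finset.mem_range.1 hkT)
      _ = (2 + √C) ^ 2 * (Kβ * (d * Real.log T)) * (2 * Real.log (B.detRatio lam ω T)) := by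
          rw [← Finset.mul_sum, ← Finset.mul_sum, B.sum_log_one_add_leverage hlam]
      _ ≤ _ := by
          gcongr
          exact B.log_detRatio_le_logConst hlam hT hX
  -- Cauchy–Schwarz over rounds produces the factor `√T`; the two factors `d log T`, from `β` and
  -- from the log-determinant, combine under the root to `d log T`.
  have hcs : (∑ k ∈ Finset.range T, g k) ^ 2 ≤ T * ∑ k ∈ Finset.range T, g k ^ 2 := by
    simpa using sq_sum_le_card_mul_sum_sq (s := Finset.range T) (f := g)
  refine abs_le_of_sq_le_sq' ?_ (by positivity) |>.2
  refine hcs.trans ((mul_le_mul_of_nonneg_left hsq (Nat.cast_nonneg T)).trans (le_of_eq ?_))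
  rw [mul_pow, mul_pow, mul_pow, mul_pow, Real.sq_sqrt (by positivity),
    Real.sq_sqrt (Nat.cast_nonneg T)]
  ring

theorem regret_le [MeasurableSpace Ω] {μ : Measure Ω} [IsProbabilityMeasure μ] (hd : 1 ≤ d)
    (hlam : 0 < lam) (hS : 0 < S) (hR : 0 ≤ R) (hlamS : 1 ≤ √lam * S) (hC : 1 ≤ C)
    (hB : B.IsMeasurable) (hsub : B.IsCondSubgaussian μ R) (hbdd : B.IsBounded L S)
    (hfol : B.FollowsLinIMED3
      { lam := lam, S := S, L := L, R := R, C := C, γ := fun t => 1 / (t : ℝ) ^ 2 })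
    {T : ℕ} (hT : 2 ≤ T) :
    B.regret μ T ≤ 1 + Real.log T +
      (2 + √C) * √(2 * (2 * R ^ 2 * logConst lam L + 2 * lam * S ^ 2 / Real.log 2) *
        logConst lam L) * (d * √(T : ℝ) * Real.log T) := by
  have hint : ∀ k ∈ Finset.range T,
      Integrable (fun ω => (B.badEvent lam R k).indicator (fun _ => (1 : ℝ)) ω) μ := fun k _ =>
    (integrable_const 1).indicator (B.measurableSet_badEvent hB R k)
  have hmono := integral_mono (μ := μ) (B.integrable_cumRegret hB hbdd T)
    ((integrable_finsetSum _ hint).add (integrable_const _))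
    (B.cumRegret_le hd hlam hS hR hlamS hC hbdd hfol hT)
  refine hmono.trans ?_
  simp only [Pi.add_apply]
  rw [integral_add (integrable_finsetSum _ hint) (integrable_const _), integral_const,
    probReal_univ, one_smul, integral_finsetSum _ hint]
  gcongr
  calc ∑ k ∈ Finset.range T, ∫ ω, (B.badEvent lam R k).indicator (fun _ => (1 : ℝ)) ω ∂μ
      ≤ ∑ k ∈ Finset.range T, 1 / ((k : ℝ) + 1) := by
        refine Finset.sum_le_sum fun k _ => ?_
        rw [integral_indicator_const _ (B.measurableSet_badEvent hB R k), smul_eq_mul, mul_one]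
        exact ENNReal.toReal_le_of_le_ofReal (by positivity)
          (B.measure_badEvent_le hlam hB hR hsub k)
    _ ≤ 1 + Real.log T := by
        have h := harmonic_le_one_add_log T
        simpa [harmonic, one_div] using h

end LinearBandit

theorem theorem3 (lam S L R C : ℝ) (hS : 0 < S) (hL : 0 < L) (hR : 0 ≤ R)
    (hlam : 0 < lam) (hlamS : 1 ≤ √lam * S) (hC : 1 ≤ C) :
    ∃ K : ℝ, ∀ (d : ℕ) (ι : Type*) (Ω : Type*) [MeasurableSpace Ω] (μ : Measure Ω)
      [IsProbabilityMeasure μ] (B : LinearBandit d ι Ω),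
      B.IsMeasurable → B.IsCondSubgaussian μ R → B.IsBounded L S →
      B.FollowsLinIMED3
        { lam := lam, S := S, L := L, R := R, C := C, γ := fun t => 1 / (t : ℝ) ^ 2 } →
      ∀ T : ℕ, 2 ≤ T →
        Integrable (B.cumRegret T) μ ∧
        B.regret μ T ≤ K * (d * √(T : ℝ) * Real.log T) := by
  refine ⟨1 / Real.log 2 + 1 + (2 + √C) * √(2 * (2 * R ^ 2 * LinearBandit.logConst lam L +
    2 * lam * S ^ 2 / Real.log 2) * LinearBandit.logConst lam L), ?_⟩
  intro d ι Ω _ μ _ B hB hsub hbdd hfol T hT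
  refine ⟨B.integrable_cumRegret hB hbdd T, ?_⟩
  have hl2 := Real.log_pos one_lt_two
  have hlT := LinearBandit.log_two_le_log hT
  have hT1 : (1 : ℝ) ≤ √(T : ℝ) := Real.one_le_sqrt.2 (by exact_mod_cast (by omega : 1 ≤ T))
  -- In dimension 0 the right-hand side vanishes, but so does every inner product and hence the
  -- regret.
  rcases Nat.eq_zero_or_pos d with rfl | hd
  · have hzero : ∀ x : EuclideanSpace ℝ (Fin 0), inner ℝ B.θ x = 0 := fun x => by
      simp [Subsingleton.elim x 0]
    simp [LinearBandit.regret, LinearBandit.cumRegret, LinearBandit.best, hzero]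
  · refine (B.regret_le hd hlam hS hR hlamS hC hB hsub hbdd hfol hT).trans ?_
    rw [add_mul _ _ ((d : ℝ) * √(T : ℝ) * Real.log T)]
    gcongr
    have hd' : (1 : ℝ) ≤ d := by exact_mod_cast hd
    -- The harmonic cost of failures is lower order: `T ≥ 2` turns the constant 1 into `log T / log
    -- 2`, which accounts for the first two terms of `K`.
    have h1 : 1 + Real.log T ≤ (1 / Real.log 2 + 1) * Real.log T := by
      rw [add_mul, one_mul, one_div, ← div_eq_inv_mul]
      gcongr
      rwa [one_le_div hl2]
    refine h1.trans ?_
    have h2 : Real.log T ≤ d * √(T : ℝ) * Real.log T :=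
      le_mul_of_one_le_left (hl2.le.trans hlT) (one_le_mul_of_one_le_of_one_le hd' hT1)
    gcongr
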